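/- For $A=(a_{ij})\in\mathbb{R}^{m\times n}$ let $\mathsf{herdisc}(A)=\max_{S\subseteq[n]}\min_{x\in\{\pm1\}^S}\|A_Sx\|_\infty$, where $A_S$ is the restriction of $A$ to the columns in $S$. For $S\subseteq[n]$ and $\lambda\ge0$ let $\mathsf{SDP}(A,S,\lambda)$ be the problem of finding $v_1,\dots,v_n\in\mathbb{R}^n$ with $\|\sum_{j\in S}a_{ij}v_j\|_2^2\le\lambda^2$ for all $i\in[m]$, $\sum_{j=1}^n\|v_j\|_2^2\ge|S|/2$, $\|v_j\|_2^2\le1$ for $j\in S$, and $v_j=0$ for $j\notin S$. Let $\mathsf{herpvdisc}(A)$ be the smallest $\lambda\ge0$ such that $\mathsf{SDP}(A,S,\lambda)$ is feasible for every $S\subseteq[n]$. Consider the following randomized algorithm with parameter $\kappa>0$. Put $s=1/(m^2n^2)$, $T=\lceil\kappa\log n/s^2\rceil$, $x_0=0\in\mathbb{R}^n$, $S_0=[n]$. For $t=1,\dots,T$: let $v_1,\dots,v_n$ be the solution of $\mathsf{SDP}(A,S_{t-1},\mathsf{herpvdisc}(A))$ returned by a solver, draw $r\in\{\pm1\}^n$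 uniformly at random and independently of the past, put $x_t(i)=x_{t-1}(i)+s\langle r,v_i\rangle$ for all $i\in[n]$, and $S_t=\{i\in S_{t-1}:|x_t(i)|<1-1/n\}$. Return $x\in\{\pm1\}^n$ with $x(i)=1$ if $x_T(i)\ge0$ and $x(i)=-1$ otherwise. Here a solver is any function that assigns to each $S\subseteq[n]$ a feasible solution of $\mathsf{SDP}(A,S,\mathsf{herpvdisc}(A))$. **Lemma.** (i) For every $c>0$ there are constants $\kappa,C>0$, depending only on $c$, such that for all $m,n\ge2$ and every $A\in\mathbb{R}^{m\times n}$ a solver exists and, for every solver, the algorithm with parameter $\kappa$ returns with probability at least $1-m^{-c}-n^{-c}$ a coloring $x\in\{\pm1\}^n$ with $$\|Ax\|_\infty\le C\sqrt{\log m\cdot\log n}\cdot\mathsf{herpvdisc}(A).$$ (ii) There is a universal constant $C>0$ such that for all $m,n\ge2$ and every $A\in\mathbb{R}^{m\times n}$, $$\mathsf{herdisc}(A)\le C\sqrt{\log m\cdot\log n}\cdot\mathsf{herpvdisc}(A).$$ -/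

import Mathlib

noncomputable section

namespace HerpvDisc

/-- The real vector with entries `+1, -1` given by a coloring with values in `ℤˣ`, whose only
elements are `1` and `-1`. -/
def signVec {ι : Type*} (ε : ι → ℤˣ) : ι → ℝ := fun j => ((ε j : ℤ) : ℝ)

/-- Discrepancy: the minimum of `‖A x‖_∞` over all `x` with entries `+1, -1`. The norm on `Fin m → ℝ`
is the maximum norm, and the infimum is over a finite nonempty set. -/
def disc {m : ℕ} {ι : Type*} [Fintype ι] (A : Matrix (Fin m) ι ℝ) : ℝ :=
  ⨅ ε : ι → ℤˣ, ‖A.mulVec (signVec ε)‖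

/-- Hereditary discrepancy: the maximum, over all sets `S` of columns, of the discrepancy of the
restriction of `A` to the columns in `S`. -/
def herdisc {m n : ℕ} (A : Matrix (Fin m) (Fin n) ℝ) : ℝ :=
  ⨆ S : Finset (Fin n), disc (A.submatrix id (fun j : S => (j : Fin n)))

/-- `v` is a feasible solution of `SDP(A, S, lam)`. -/
structure IsSDPSolution {m n : ℕ} (A : Matrix (Fin m) (Fin n) ℝ) (S : Finset (Fin n)) (lam : ℝ)
    (v : Fin n → EuclideanSpace ℝ (Fin n)) : Prop where
  row_le : ∀ i, ‖∑ j ∈ S, A i j • v j‖ ^ 2 ≤ lam ^ 2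
  half_le : (S.card : ℝ) / 2 ≤ ∑ j, ‖v j‖ ^ 2
  norm_le : ∀ j ∈ S, ‖v j‖ ^ 2 ≤ 1
  norm_eq_zero : ∀ j, j ∉ S → ‖v j‖ ^ 2 = 0

/-- Hereditary partial vector discrepancy: the smallest `lam ≥ 0` such that `SDP(A, S, lam)` is
feasible for every `S`. See `herpvdisc_isLeast`: the infimum is attained. -/
def herpvdisc {m n : ℕ} (A : Matrix (Fin m) (Fin n) ℝ) : ℝ :=
  sInf {lam : ℝ | 0 ≤ lam ∧ ∀ S : Finset (Fin n), ∃ v, IsSDPSolution A S lam v}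

theorem herpvdisc_set_nonempty {m n : ℕ} (A : Matrix (Fin m) (Fin n) ℝ) :
    {lam : ℝ | 0 ≤ lam ∧ ∀ S : Finset (Fin n), ∃ v, IsSDPSolution A S lam v}.Nonempty := by
  classical
  have h0 : ∀ i, 0 ≤ ∑ j, |A i j| := fun i => Finset.sum_nonneg fun j _ => abs_nonneg _
  refine ⟨∑ i, ∑ j, |A i j|, Finset.sum_nonneg fun i _ => h0 i, fun S =>
    ⟨fun j => if j ∈ S then EuclideanSpace.single j (1 : ℝ) else 0, ?_, ?_, ?_, ?_⟩⟩
  · intro i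
    refine pow_le_pow_left₀ (norm_nonneg _) ?_ 2
    calc ‖∑ j ∈ S, A i j • (if j ∈ S then EuclideanSpace.single j (1 : ℝ) else 0)‖
        ≤ ∑ j ∈ S, |A i j| := by
          refine norm_sum_le_of_le _ fun j hj => ?_
          simp [hj, norm_smul]
      _ ≤ ∑ j, |A i j| := Finset.sum_le_sum_of_subset_of_nonneg (Finset.subset_univ _)
          fun j _ _ => abs_nonneg _
      _ ≤ ∑ i, ∑ j, |A i j| :=
          Finset.single_le_sum (f := fun i => ∑ j, |A i j|) (fun i _ => h0 i) (Finset.mem_univ i)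
  · have : ∀ j : Fin n, ‖(if j ∈ S then EuclideanSpace.single j (1 : ℝ) else 0 :
        EuclideanSpace ℝ (Fin n))‖ ^ 2 = if j ∈ S then 1 else 0 := by
      intro j; split_ifs <;> simp
    simp only [this, Finset.sum_ite_mem, Finset.univ_inter, Finset.sum_const, nsmul_eq_mul, mul_one]
    linarith [(Nat.cast_nonneg S.card : (0 : ℝ) ≤ S.card)]
  · intro j hj; simp [hj]
  · intro j hj; simp [hj]

theorem herpvdisc_isLeast {m n : ℕ} (A : Matrix (Fin m) (Fin n) ℝ) :
    IsLeast {lam : ℝ | 0 ≤ lam ∧ ∀ S : Finset (Fin n), ∃ v, IsSDPSolution A S lam v}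
      (herpvdisc A) := by
  have hne := herpvdisc_set_nonempty A
  refine ⟨⟨le_csInf hne fun b hb => hb.1, fun S => ?_⟩, fun b hb => csInf_le ⟨0, fun c hc => hc.1⟩ hb⟩
  let K : Set (Fin n → EuclideanSpace ℝ (Fin n)) :=
    {v | (S.card : ℝ) / 2 ≤ ∑ j, ‖v j‖ ^ 2 ∧ (∀ j ∈ S, ‖v j‖ ^ 2 ≤ 1) ∧
      ∀ j, j ∉ S → ‖v j‖ ^ 2 = 0}
  let f : (Fin n → EuclideanSpace ℝ (Fin n)) → ℝ :=
    fun v => ‖fun i : Fin m => ‖∑ j ∈ S, A i j • v j‖‖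
  have hf : Continuous f := by fun_prop
  have hsub : K ⊆ Metric.closedBall 0 1 := by
    intro v hv
    rw [mem_closedBall_zero_iff, pi_norm_le_iff_of_nonneg zero_le_one]
    intro j
    by_cases hj : j ∈ S
    · have := hv.2.1 j hj
      nlinarith [norm_nonneg (v j)]
    · have := hv.2.2 j hj
      nlinarith [norm_nonneg (v j)]
  have hcl : IsClosed K := by
    have h1 : IsClosed {v : Fin n → EuclideanSpace ℝ (Fin n) |
        (S.card : ℝ) / 2 ≤ ∑ j, ‖v j‖ ^ 2} := isClosed_le continuous_const (by fun_prop)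
    have h2 : IsClosed {v : Fin n → EuclideanSpace ℝ (Fin n) | ∀ j ∈ S, ‖v j‖ ^ 2 ≤ 1} := by
      simp only [Set.ofPred_forall]
      exact isClosed_iInter fun j => isClosed_iInter fun _ =>
        isClosed_le (by fun_prop) continuous_const
    have h3 : IsClosed {v : Fin n → EuclideanSpace ℝ (Fin n) | ∀ j, j ∉ S → ‖v j‖ ^ 2 = 0} := by
      simp only [Set.ofPred_forall]
      exact isClosed_iInter fun j => isClosed_iInter fun _ =>
        isClosed_eq (by fun_prop) continuous_const
    exact h1.inter (h2.inter h3)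
  have hK : IsCompact K := (isCompact_closedBall _ _).of_isClosed_subset hcl hsub
  have hKne : K.Nonempty := by
    obtain ⟨b, hb⟩ := hne
    obtain ⟨v, hv⟩ := hb.2 S
    exact ⟨v, hv.half_le, hv.norm_le, hv.norm_eq_zero⟩
  obtain ⟨w, hw, hmin⟩ := hK.exists_isMinOn hKne hf.continuousOn
  have hle : f w ≤ herpvdisc A := by
    refine le_csInf hne fun b hb => ?_
    obtain ⟨v, hv⟩ := hb.2 S
    refine (hmin (show v ∈ K from ⟨hv.half_le, hv.norm_le, hv.norm_eq_zero⟩)).trans ?_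
    refine (pi_norm_le_iff_of_nonneg hb.1).2 fun i => ?_
    rw [norm_norm]
    exact le_of_sq_le_sq (hv.row_le i) hb.1
  refine ⟨w, fun i => pow_le_pow_left₀ (norm_nonneg _) ?_ 2, hw.1, hw.2.1, hw.2.2⟩
  have := norm_le_pi_norm (fun i : Fin m => ‖∑ j ∈ S, A i j • w j‖) i
  rw [norm_norm] at this
  exact this.trans hle

/-- `V` is an exact solver for the programs `SDP(A, S, lam)` with `lam = herpvdisc A`:
for every set `S` it returns some feasible solution. -/
def IsSDPSolver {m n : ℕ} (A : Matrix (Fin m) (Fin n) ℝ)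
    (V : Finset (Fin n) → Fin n → EuclideanSpace ℝ (Fin n)) : Prop :=
  ∀ S, IsSDPSolution A S (herpvdisc A) (V S)

/-- The state of the random walk: the fractional coloring and the set of alive elements. -/
structure WalkState (n : ℕ) where
  /-- the current fractional coloring -/
  pos : Fin n → ℝ
  /-- the set of elements that are still alive -/
  alive : Finset (Fin n)

/-- The step size `s = 1 / (m² n²)`. -/
def stepSize (m n : ℕ) : ℝ := 1 / ((m : ℝ) ^ 2 * (n : ℝ) ^ 2)

/-- The number `T = ⌈κ log n / s²⌉` of iterations. -/
def numSteps (κ : ℝ) (m n : ℕ) : ℕ := ⌈κ * Real.log n / stepSize m n ^ 2⌉₊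

/-- One iteration with random signs `r`: every coordinate `x i` moves by `s ⟨r, v i⟩`, where `v` is
the SDP solution for the current alive set; an alive element stops being alive as soon as
`|x i| ≥ 1 - 1 / n`. -/
def walkStep (m : ℕ) {n : ℕ} (V : Finset (Fin n) → Fin n → EuclideanSpace ℝ (Fin n))
    (σ : WalkState n) (r : Fin n → ℤˣ) : WalkState n where
  pos := fun i => σ.pos i + stepSize m n * inner ℝ (WithLp.toLp 2 (signVec r)) (V σ.alive i)
  alive := σ.alive.filter fun i =>
    |σ.pos i + stepSize m n * inner ℝ (WithLp.toLp 2 (signVec r)) (V σ.alive i)| < 1 - 1 / (n : ℝ)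

/-- The distribution of the state after `t` iterations. The walk starts at the origin with all
elements alive, and every iteration uses a fresh uniformly random `r` with entries `+1, -1`. -/
def walk (m : ℕ) {n : ℕ} (V : Finset (Fin n) → Fin n → EuclideanSpace ℝ (Fin n)) :
    ℕ → PMF (WalkState n)
  | 0 => PMF.pure ⟨fun _ => 0, Finset.univ⟩
  | t + 1 => (walk m V t).bind fun σ =>
      (PMF.uniformOfFintype (Fin n → ℤˣ)).map (walkStep m V σ)

/-- Rounding of a fractional coloring to a nearest coloring. -/
def roundSigns {n : ℕ} (x : Fin n → ℝ) : Fin n → ℤˣ := fun i => if 0 ≤ x i then 1 else -1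

/-- The distribution of the coloring returned by the randomized rounding algorithm for an
`m × n` matrix, when the semidefinite programs are solved by `V`. -/
def herpvdiscRounding (κ : ℝ) (m : ℕ) {n : ℕ}
    (V : Finset (Fin n) → Fin n → EuclideanSpace ℝ (Fin n)) : PMF (Fin n → ℤˣ) :=
  (walk m V (numSteps κ m n)).map fun σ => roundSigns σ.pos

end HerpvDisc

end

/-!
The proof follows two potentials of the random walk, each of which contracts or grows by a
controlled factor in a single step, and combines them by Markov's inequality.

*All elements die.* The increment of `x i` has mean zero and second moment `s² ‖v i‖²`, so the mean
of `∑ (2 - x i ²)` over the alive set `S` drops by at least `s² ∑ ‖v i‖² ≥ s² |S| / 2` in a step.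
The sum is at most `2 |S|`, so its mean shrinks by the factor `1 - s² / 4`
(`expect_aliveEnergy_walkStep_le`). After `T ≥ κ log n / s²` steps the mean is at most
`2 n ^ (1 - κ / 4)`, while a single alive element contributes at least `1` to the sum.

*Rows stay small.* The increment of row `i` of `A x` is `s ⟨r, ∑ j, A i j • v j⟩`, a Rademacher sum
with variance proxy at most `(s λ)²`, where `λ = herpvdisc A`. Hence the mean of `exp (θ (A x) i)`
grows by a factor of at most `exp ((θ s λ)² / 2)` in a step (`expect_exp_row_walkStep_le`), and
Chernoff's bound with `T s² ≤ (κ + 1) log n` gives rows of size `O(√(log m log n) λ)`.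

Both bounds enter `one_le_prob_dead_and_rows_le`. Once all elements are dead, rounding moves each
coordinate by at most `1 / n`, and the programs for single columns show that all entries of `A` are
at most `2 λ`, so rounding costs at most `2 λ` in each row (`norm_mulVec_roundSigns_le`).

The bound on `herdisc A` follows by running the algorithm on `A` with the columns outside `S` set to
zero. This does not increase `herpvdisc` (`herpvdisc_zeroOutside_le`), and it keeps the number of
columns equal to `n`, so no set `S` needs a separate treatment.
-/

open scoped BigOperators ENNReal

namespace HerpvDisc

/-! ### Moments of a uniformly random sign vector -/

section Signs

variable {n : ℕ}

theorem inner_signVec (r : Fin n → ℤˣ) (v : EuclideanSpace ℝ (Fin n)) :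
    inner ℝ (WithLp.toLp 2 (signVec r)) v = ∑ k, ((r k : ℤ) : ℝ) * v k := by
  simp [PiLp.inner_apply, signVec, mul_comm]

theorem abs_sign (u : ℤˣ) : |((u : ℤ) : ℝ)| = 1 := by
  rcases Int.units_eq_one_or u with rfl | rfl <;> simp

theorem abs_inner_signVec_le (r : Fin n → ℤˣ) (v : EuclideanSpace ℝ (Fin n)) (hv : ‖v‖ ^ 2 ≤ 1) :
    |inner ℝ (WithLp.toLp 2 (signVec r)) v| ≤ n := by
  have hv1 : ‖v‖ ≤ 1 := by nlinarith [norm_nonneg v]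
  rw [inner_signVec]
  calc |∑ k, ((r k : ℤ) : ℝ) * v k| ≤ ∑ k, |((r k : ℤ) : ℝ) * v k| := Finset.abs_sum_le_sum_abs _ _
    _ ≤ ∑ _k : Fin n, (1 : ℝ) := by
        refine Finset.sum_le_sum fun k _ => ?_
        rw [abs_mul, abs_sign, one_mul]
        exact (PiLp.norm_apply_le v k).trans hv1
    _ = n := by simp

theorem expect_inner_signVec (v : EuclideanSpace ℝ (Fin n)) :
    𝔼 r : Fin n → ℤˣ, inner ℝ (WithLp.toLp 2 (signVec r)) v = 0 := by
  have h : 𝔼 r : Fin n → ℤˣ, inner ℝ (WithLp.toLp 2 (signVec r)) v =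
      𝔼 r : Fin n → ℤˣ, -inner ℝ (WithLp.toLp 2 (signVec r)) v :=
    Fintype.expect_equiv (Equiv.neg _) _ _ fun r => by simp [inner_signVec]
  rw [Finset.expect_neg_distrib] at h
  linarith

theorem expect_sign_mul_sign (i j : Fin n) :
    𝔼 r : Fin n → ℤˣ, ((r i : ℤ) : ℝ) * ((r j : ℤ) : ℝ) = if i = j then 1 else 0 := by
  split_ifs with hij
  · subst hij
    have : ∀ r : Fin n → ℤˣ, ((r i : ℤ) : ℝ) * ((r i : ℤ) : ℝ) = 1 := fun r => by
      rcases Int.units_eq_one_or (r i) with h | h <;> simp [h]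
    simp only [this]
    exact Fintype.expect_const _
  · -- Flipping the sign of the `i`-th coordinate is a bijection that negates the summand.
    have h : 𝔼 r : Fin n → ℤˣ, ((r i : ℤ) : ℝ) * ((r j : ℤ) : ℝ) =
        𝔼 r : Fin n → ℤˣ, -(((r i : ℤ) : ℝ) * ((r j : ℤ) : ℝ)) :=
      Fintype.expect_equiv (Equiv.mulLeft (Function.update (1 : Fin n → ℤˣ) i (-1))) _ _ fun r => by
        simp [Function.update_of_ne (Ne.symm hij)]
    rw [Finset.expect_neg_distrib] at h
    linarith

theorem expect_inner_signVec_sq (v : EuclideanSpace ℝ (Fin n)) :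
    𝔼 r : Fin n → ℤˣ, inner ℝ (WithLp.toLp 2 (signVec r)) v ^ 2 = ‖v‖ ^ 2 := by
  have h : ∀ r : Fin n → ℤˣ, inner ℝ (WithLp.toLp 2 (signVec r)) v ^ 2 =
      ∑ i, ∑ j, (((r i : ℤ) : ℝ) * ((r j : ℤ) : ℝ)) * (v i * v j) := fun r => by
    rw [inner_signVec, sq, Finset.sum_mul_sum]
    exact Finset.sum_congr rfl fun i _ => Finset.sum_congr rfl fun j _ => by ring
  simp only [h, Finset.expect_sum_comm, ← Finset.expect_mul, expect_sign_mul_sign]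
  rw [EuclideanSpace.norm_sq_eq]
  simp [sq]

/-- A Rademacher sum `⟨r, v⟩` is sub-Gaussian with variance proxy `‖v‖²`: its moment generating
function is the product of the `cosh (v k)`. -/
theorem expect_exp_inner_signVec_le (v : EuclideanSpace ℝ (Fin n)) :
    𝔼 r : Fin n → ℤˣ, Real.exp (inner ℝ (WithLp.toLp 2 (signVec r)) v) ≤
      Real.exp (‖v‖ ^ 2 / 2) := by
  have hsum : ∑ r : Fin n → ℤˣ, Real.exp (inner ℝ (WithLp.toLp 2 (signVec r)) v) =
      ∏ k, ∑ u : ℤˣ, Real.exp (((u : ℤ) : ℝ) * v k) := by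
    rw [Finset.prod_univ_sum, Fintype.piFinset_univ]
    exact Finset.sum_congr rfl fun r _ => by rw [inner_signVec, Real.exp_sum]
  have hcosh : ∀ k, ∑ u : ℤˣ, Real.exp (((u : ℤ) : ℝ) * v k) = 2 * Real.cosh (v k) := fun k => by
    rw [Real.cosh_eq, show (Finset.univ : Finset ℤˣ) = {1, -1} from rfl,
      Finset.sum_pair (by decide)]
    push_cast
    ring_nf
  rw [Fintype.expect_eq_sum_div_card, hsum]
  simp only [hcosh, Finset.prod_mul_distrib]
  rw [EuclideanSpace.norm_sq_eq, Finset.sum_div, Real.exp_sum]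
  simp only [Fintype.card_pi, Fintype.card_units_int, Finset.prod_const, Finset.card_univ,
    Fintype.card_fin, Nat.cast_pow, Nat.cast_ofNat, Real.norm_eq_abs, sq_abs]
  rw [mul_div_cancel_left₀ _ (by positivity)]
  exact Finset.prod_le_prod (fun k _ => (Real.cosh_pos _).le) fun k _ => Real.cosh_le_exp_half_sq _

end Signs

/-! ### Expectations of potentials along the walk -/

/-- The expectation of a nonnegative function under a discrete distribution, as a sum in `ℝ≥0∞`,
so that no summability has to be tracked. -/
noncomputable def pmfExpect {α : Type*} (p : PMF α) (f : α → ℝ≥0∞) : ℝ≥0∞ := ∑' a, p a * f a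

section PmfExpect

variable {α β : Type*}

theorem pmfExpect_pure (a : α) (f : α → ℝ≥0∞) : pmfExpect (PMF.pure a) f = f a := by
  rw [pmfExpect, tsum_eq_single a fun b hb => by simp [PMF.pure_apply, hb]]
  simp

theorem pmfExpect_bind (p : PMF α) (q : α → PMF β) (f : β → ℝ≥0∞) :
    pmfExpect (p.bind q) f = pmfExpect p fun a => pmfExpect (q a) f := by
  simp only [pmfExpect, PMF.bind_apply, ← ENNReal.tsum_mul_right, ← ENNReal.tsum_mul_left]
  rw [ENNReal.tsum_comm]
  simp only [mul_assoc]

theorem pmfExpect_map (p : PMF α) (g : α → β) (f : β → ℝ≥0∞) :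
    pmfExpect (p.map g) f = pmfExpect p (f ∘ g) := by
  rw [PMF.map, pmfExpect_bind]
  simp only [Function.comp_apply, pmfExpect_pure]
  rfl

theorem pmfExpect_mono {p : PMF α} {f g : α → ℝ≥0∞} (h : ∀ a ∈ p.support, f a ≤ g a) :
    pmfExpect p f ≤ pmfExpect p g := by
  refine ENNReal.tsum_le_tsum fun a => ?_
  by_cases ha : p a = 0
  · simp [ha]
  · gcongr
    exact h a ha

theorem pmfExpect_add (p : PMF α) (f g : α → ℝ≥0∞) :
    pmfExpect p (fun a => f a + g a) = pmfExpect p f + pmfExpect p g := by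
  simp only [pmfExpect, mul_add, ENNReal.tsum_add]

theorem pmfExpect_const_mul (p : PMF α) (c : ℝ≥0∞) (f : α → ℝ≥0∞) :
    pmfExpect p (fun a => c * f a) = c * pmfExpect p f := by
  simp only [pmfExpect, ← ENNReal.tsum_mul_left, mul_left_comm]

theorem pmfExpect_sum {ι : Type*} (p : PMF α) (s : Finset ι) (f : ι → α → ℝ≥0∞) :
    pmfExpect p (fun a => ∑ i ∈ s, f i a) = ∑ i ∈ s, pmfExpect p (f i) := by
  simp only [pmfExpect, Finset.mul_sum]
  exact Summable.tsum_finsetSum fun i _ => ENNReal.summable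

theorem pmfExpect_uniform [Fintype α] [Nonempty α] (f : α → ℝ) (hf : ∀ a, 0 ≤ f a) :
    pmfExpect (PMF.uniformOfFintype α) (fun a => ENNReal.ofReal (f a)) =
      ENNReal.ofReal (𝔼 a, f a) := by
  have hc : (0 : ℝ) < Fintype.card α := by exact_mod_cast Fintype.card_pos
  rw [pmfExpect, tsum_fintype, Fintype.expect_eq_sum_div_card, ENNReal.ofReal_div_of_pos hc,
    ENNReal.ofReal_sum_of_nonneg fun a _ => hf a, ENNReal.ofReal_natCast, div_eq_mul_inv, mul_comm,
    Finset.mul_sum]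
  simp [PMF.uniformOfFintype_apply]

/-- Markov's inequality for a union bound: if the function `f` is at least `1` wherever the event
`s` fails, then `s` fails with probability at most the expectation of `f`. -/
theorem one_le_toOuterMeasure_add_pmfExpect (p : PMF α) (s : Set α) (f : α → ℝ≥0∞)
    (h : ∀ a ∈ p.support, a ∉ s → 1 ≤ f a) : 1 ≤ p.toOuterMeasure s + pmfExpect p f := by
  rw [PMF.toOuterMeasure_apply, pmfExpect, ← ENNReal.tsum_add, ← p.tsum_coe]
  refine ENNReal.tsum_le_tsum fun a => ?_
  by_cases ha : p a = 0
  · simp [ha]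
  by_cases has : a ∈ s
  · simp [has]
  · simpa [has] using mul_le_mul_right (h a ha has) (p a)

theorem nonempty_of_toReal_toOuterMeasure_pos {p : PMF α} {s : Set α}
    (h : 0 < (p.toOuterMeasure s).toReal) : s.Nonempty := by
  rw [Set.nonempty_iff_ne_empty]
  rintro rfl
  simp at h

end PmfExpect

section Walk

variable {m n : ℕ} {V : Finset (Fin n) → Fin n → EuclideanSpace ℝ (Fin n)}

/-- The starting state of the walk. -/
def initState (n : ℕ) : WalkState n := ⟨fun _ => 0, Finset.univ⟩

theorem walk_support {I : WalkState n → Prop} (h0 : I (initState n))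
    (hI : ∀ σ r, I σ → I (walkStep m V σ r)) (t : ℕ) : ∀ σ ∈ (walk m V t).support, I σ := by
  induction t with
  | zero =>
    intro σ hσ
    rw [walk, PMF.support_pure, Set.mem_singleton_iff] at hσ
    exact hσ ▸ h0
  | succ t ih =>
    intro σ hσ
    rw [walk, PMF.mem_support_bind_iff] at hσ
    obtain ⟨τ, hτ, h⟩ := hσ
    rw [PMF.mem_support_map_iff] at h
    obtain ⟨r, -, rfl⟩ := h
    exact hI τ r (ih τ hτ)

/-- A potential that is nonnegative on an invariant set of states, and whose mean grows by a factor
of at most `K` in each step, has mean at most `K ^ t` times its initial value at time `t`. -/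
theorem pmfExpect_walk_le {I : WalkState n → Prop} (h0 : I (initState n))
    (hI : ∀ σ r, I σ → I (walkStep m V σ r)) {f : WalkState n → ℝ} (hf : ∀ σ, I σ → 0 ≤ f σ)
    {K : ℝ} (hK0 : 0 ≤ K) (hK : ∀ σ, I σ → 𝔼 r, f (walkStep m V σ r) ≤ K * f σ) (t : ℕ) :
    pmfExpect (walk m V t) (fun σ => ENNReal.ofReal (f σ)) ≤
      ENNReal.ofReal (K ^ t * f (initState n)) := by
  induction t with
  | zero =>
    rw [walk, pmfExpect_pure, pow_zero, one_mul]
    rfl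
  | succ t ih =>
    rw [walk, pmfExpect_bind]
    calc _ ≤ pmfExpect (walk m V t) (fun σ => ENNReal.ofReal K * ENNReal.ofReal (f σ)) := by
          refine pmfExpect_mono fun σ hσ => ?_
          have hσI := walk_support h0 hI t σ hσ
          rw [pmfExpect_map, ← ENNReal.ofReal_mul hK0]
          simp only [Function.comp_def]
          rw [pmfExpect_uniform _ fun r => hf _ (hI σ r hσI)]
          exact ENNReal.ofReal_le_ofReal (hK σ hσI)
      _ = ENNReal.ofReal K * pmfExpect (walk m V t) (fun σ => ENNReal.ofReal (f σ)) := by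
          rw [pmfExpect_const_mul]
      _ ≤ ENNReal.ofReal K * ENNReal.ofReal (K ^ t * f (initState n)) := by gcongr
      _ = _ := by rw [← ENNReal.ofReal_mul hK0, pow_succ', mul_assoc]

/-! ### Invariants of the walk -/

/-- The states that the walk can reach: the fractional coloring stays in the cube `[-1, 1]ⁿ`, and
the alive elements are exactly those with `|x i| < 1 - 1 / n`. -/
structure WalkInvariant (σ : WalkState n) : Prop where
  abs_le : ∀ i, |σ.pos i| ≤ 1
  mem_alive : ∀ i, i ∈ σ.alive ↔ |σ.pos i| < 1 - 1 / (n : ℝ)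

theorem stepSize_pos (hm : 2 ≤ m) (hn : 2 ≤ n) : 0 < stepSize m n := by
  have : 0 < m := by lia
  have : 0 < n := by lia
  unfold stepSize
  positivity

theorem stepSize_mul_le (hm : 2 ≤ m) (hn : 2 ≤ n) : stepSize m n * n ≤ 1 / n := by
  have hm' : (2 : ℝ) ≤ m := by exact_mod_cast hm
  have hn' : (2 : ℝ) ≤ n := by exact_mod_cast hn
  rw [stepSize, div_mul_eq_mul_div, div_le_div_iff₀ (by positivity) (by positivity)]
  nlinarith [sq_nonneg (n : ℝ), mul_nonneg (sq_nonneg (n : ℝ)) (by nlinarith : 0 ≤ (m : ℝ) ^ 2 - 1)]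

theorem stepSize_le (hm : 2 ≤ m) (hn : 2 ≤ n) : stepSize m n ≤ 1 / 4 := by
  have h := stepSize_mul_le hm hn
  have hn' : (2 : ℝ) ≤ n := by exact_mod_cast hn
  have h2 : (1 : ℝ) / n ≤ 1 / 2 := one_div_le_one_div_of_le (by norm_num) hn'
  nlinarith [stepSize_pos hm hn]

theorem walkInvariant_initState (hn : 2 ≤ n) : WalkInvariant (initState n) := by
  have hn' : (2 : ℝ) ≤ n := by exact_mod_cast hn
  have h2 : (1 : ℝ) / n ≤ 1 / 2 := one_div_le_one_div_of_le (by norm_num) hn'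
  refine ⟨fun i => by simp [initState], fun i => ?_⟩
  simp only [initState, Finset.mem_univ, abs_zero, true_iff]
  linarith

variable {A : Matrix (Fin m) (Fin n) ℝ}

theorem IsSDPSolution.eq_zero {S : Finset (Fin n)} {lam : ℝ}
    {v : Fin n → EuclideanSpace ℝ (Fin n)} (h : IsSDPSolution A S lam v) {j : Fin n} (hj : j ∉ S) :
    v j = 0 := by
  simpa using h.norm_eq_zero j hj

theorem walkInvariant_walkStep (hm : 2 ≤ m) (hn : 2 ≤ n) (hV : IsSDPSolver A V) (σ : WalkState n)
    (r : Fin n → ℤˣ) (hσ : WalkInvariant σ) : WalkInvariant (walkStep m V σ r) := by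
  refine ⟨fun i => ?_, fun i => ?_⟩
  · by_cases hi : i ∈ σ.alive
    · have h1 := (hσ.mem_alive i).1 hi
      have h2 := abs_inner_signVec_le r _ ((hV σ.alive).norm_le i hi)
      have h3 := stepSize_mul_le hm hn
      have hs := stepSize_pos hm hn
      calc _ ≤ |σ.pos i| + |stepSize m n * inner ℝ (WithLp.toLp 2 (signVec r)) (V σ.alive i)| :=
            abs_add_le _ _
        _ ≤ (1 - 1 / (n : ℝ)) + stepSize m n * n := by
            rw [abs_mul, abs_of_pos hs]
            gcongr
        _ ≤ 1 := by linarith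
    · simpa [walkStep, (hV σ.alive).eq_zero hi] using hσ.abs_le i
  · simp only [walkStep, Finset.mem_filter, and_iff_right_iff_imp]
    intro h
    by_contra hi
    rw [(hV σ.alive).eq_zero hi, inner_zero_right, mul_zero, add_zero] at h
    exact hi ((hσ.mem_alive i).2 h)

/-! ### The two potentials -/

/-- The energy that the alive elements still have to gain. The constant `2` makes every alive
element contribute at least `1`. -/
def aliveEnergy (σ : WalkState n) : ℝ := ∑ i ∈ σ.alive, (2 - σ.pos i ^ 2)

theorem WalkInvariant.one_le {σ : WalkState n} (hσ : WalkInvariant σ) (i : Fin n) :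
    1 ≤ 2 - σ.pos i ^ 2 := by
  have := (sq_le_one_iff_abs_le_one _).2 (hσ.abs_le i)
  linarith

theorem WalkInvariant.aliveEnergy_nonneg {σ : WalkState n} (hσ : WalkInvariant σ) :
    0 ≤ aliveEnergy σ :=
  Finset.sum_nonneg fun i _ => zero_le_one.trans (hσ.one_le i)

theorem expect_aliveEnergy_walkStep_le (hm : 2 ≤ m) (hn : 2 ≤ n) (hV : IsSDPSolver A V)
    (σ : WalkState n) (hσ : WalkInvariant σ) :
    𝔼 r, aliveEnergy (walkStep m V σ r) ≤ (1 - stepSize m n ^ 2 / 4) * aliveEnergy σ := by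
  set s := stepSize m n with hs
  have hsol := hV σ.alive
  -- Elements that die in this step only lower the potential.
  have hdrop : ∀ r, aliveEnergy (walkStep m V σ r) ≤
      ∑ i ∈ σ.alive, (2 - (walkStep m V σ r).pos i ^ 2) := fun r =>
    Finset.sum_le_sum_of_subset_of_nonneg (Finset.filter_subset _ _) fun i _ _ =>
      zero_le_one.trans ((walkInvariant_walkStep hm hn hV σ r hσ).one_le i)
  have hmean : ∀ i, 𝔼 r, (2 - (walkStep m V σ r).pos i ^ 2) =
      2 - σ.pos i ^ 2 - s ^ 2 * ‖V σ.alive i‖ ^ 2 := fun i => by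
    have : ∀ r, 2 - (walkStep m V σ r).pos i ^ 2 = (2 - σ.pos i ^ 2) -
        (2 * σ.pos i * s) * inner ℝ (WithLp.toLp 2 (signVec r)) (V σ.alive i) -
        s ^ 2 * inner ℝ (WithLp.toLp 2 (signVec r)) (V σ.alive i) ^ 2 := fun r => by
      simp only [walkStep]
      ring
    simp only [this, Finset.expect_sub_distrib, ← Finset.mul_expect, expect_inner_signVec,
      expect_inner_signVec_sq, Fintype.expect_const, mul_zero, sub_zero]
  have hgain : (σ.alive.card : ℝ) / 2 ≤ ∑ i ∈ σ.alive, ‖V σ.alive i‖ ^ 2 := by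
    refine hsol.half_le.trans_eq (Finset.sum_subset (Finset.subset_univ _) fun i _ hi => ?_).symm
    exact hsol.norm_eq_zero i hi
  have hcard : aliveEnergy σ ≤ 2 * σ.alive.card := by
    calc aliveEnergy σ ≤ ∑ i ∈ σ.alive, (2 : ℝ) :=
          Finset.sum_le_sum fun i _ => by linarith [sq_nonneg (σ.pos i)]
      _ = _ := by simp [mul_comm]
  calc 𝔼 r, aliveEnergy (walkStep m V σ r)
      ≤ 𝔼 r, ∑ i ∈ σ.alive, (2 - (walkStep m V σ r).pos i ^ 2) :=
        Finset.expect_le_expect fun r _ => hdrop r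
    _ = aliveEnergy σ - s ^ 2 * ∑ i ∈ σ.alive, ‖V σ.alive i‖ ^ 2 := by
        rw [Finset.expect_sum_comm]
        simp only [hmean, Finset.sum_sub_distrib, Finset.mul_sum, aliveEnergy]
    _ ≤ _ := by nlinarith [sq_nonneg s, mul_le_mul_of_nonneg_left hgain (sq_nonneg s),
          mul_le_mul_of_nonneg_left hcard (sq_nonneg s)]

theorem IsSDPSolution.norm_row_le {S : Finset (Fin n)} {lam : ℝ}
    {v : Fin n → EuclideanSpace ℝ (Fin n)} (h : IsSDPSolution A S lam v) (i : Fin m) :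
    ‖∑ j, A i j • v j‖ ^ 2 ≤ lam ^ 2 := by
  convert h.row_le i using 3
  refine (Finset.sum_subset (Finset.subset_univ _) fun j _ hj => ?_).symm
  rw [h.eq_zero hj, smul_zero]

/-- The exponential moment of a row of `A x` grows by a factor of at most `exp ((θ s λ)² / 2)` in a
step, since its increment is a Rademacher sum with variance at most `(s λ)²`. -/
theorem expect_exp_row_walkStep_le (hV : IsSDPSolver A V) (i : Fin m) (θ : ℝ) (σ : WalkState n) :
    𝔼 r, Real.exp (θ * A.mulVec (walkStep m V σ r).pos i) ≤
      Real.exp (θ ^ 2 * stepSize m n ^ 2 * herpvdisc A ^ 2 / 2) *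
        Real.exp (θ * A.mulVec σ.pos i) := by
  set w := (θ * stepSize m n) • ∑ j, A i j • V σ.alive j with hw
  have hstep : ∀ r, Real.exp (θ * A.mulVec (walkStep m V σ r).pos i) =
      Real.exp (θ * A.mulVec σ.pos i) * Real.exp (inner ℝ (WithLp.toLp 2 (signVec r)) w) := by
    intro r
    rw [← Real.exp_add, hw, inner_smul_right, inner_sum]
    simp only [inner_smul_right, Matrix.mulVec, dotProduct, walkStep, Finset.mul_sum]
    rw [← Finset.sum_add_distrib]
    exact congrArg _ (Finset.sum_congr rfl fun j _ => by ring)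
  simp only [hstep, ← Finset.mul_expect]
  rw [mul_comm]
  gcongr
  refine (expect_exp_inner_signVec_le w).trans (Real.exp_le_exp.2 ?_)
  have := (hV σ.alive).norm_row_le i
  rw [hw, norm_smul, mul_pow, Real.norm_eq_abs, sq_abs, mul_pow]
  gcongr

theorem pmfExpect_aliveEnergy_le (hm : 2 ≤ m) (hn : 2 ≤ n) (hV : IsSDPSolver A V) (t : ℕ) :
    pmfExpect (walk m V t) (fun σ => ENNReal.ofReal (aliveEnergy σ)) ≤
      ENNReal.ofReal (2 * n * Real.exp (-(t * stepSize m n ^ 2 / 4))) := by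
  have hs := stepSize_pos hm hn
  have hs' := stepSize_le hm hn
  have hK : 0 ≤ 1 - stepSize m n ^ 2 / 4 := by nlinarith
  refine (pmfExpect_walk_le (walkInvariant_initState hn) (walkInvariant_walkStep hm hn hV)
    (fun σ hσ => hσ.aliveEnergy_nonneg) hK (expect_aliveEnergy_walkStep_le hm hn hV) t).trans
    (ENNReal.ofReal_le_ofReal ?_)
  have h1 : aliveEnergy (initState n) = 2 * n := by simp [aliveEnergy, initState, mul_comm]
  rw [h1, mul_comm]
  gcongr
  calc (1 - stepSize m n ^ 2 / 4) ^ t ≤ Real.exp (-(stepSize m n ^ 2 / 4)) ^ t := by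
        gcongr
        exact Real.one_sub_le_exp_neg _
    _ = _ := by rw [← Real.exp_nat_mul]; ring_nf

theorem pmfExpect_exp_row_le (hV : IsSDPSolver A V) (i : Fin m) (θ : ℝ) (t : ℕ) :
    pmfExpect (walk m V t) (fun σ => ENNReal.ofReal (Real.exp (θ * A.mulVec σ.pos i))) ≤
      ENNReal.ofReal (Real.exp (θ ^ 2 * herpvdisc A ^ 2 * (t * stepSize m n ^ 2) / 2)) := by
  refine (pmfExpect_walk_le (I := fun _ => True) trivial (fun _ _ _ => trivial)
    (fun σ _ => (Real.exp_pos _).le) (Real.exp_pos _).le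
    (fun σ _ => expect_exp_row_walkStep_le hV i θ σ) t).trans_eq ?_
  have h0 : A.mulVec (initState n).pos = 0 := Matrix.mulVec_zero A
  rw [h0, Pi.zero_apply, mul_zero, Real.exp_zero, mul_one, ← Real.exp_nat_mul]
  ring_nf

/-- With high probability all elements are dead and all rows of the fractional coloring are small.
This is a union bound over the element potential and the exponential moments of the rows. -/
theorem one_le_prob_dead_and_rows_le (hm : 2 ≤ m) (hn : 2 ≤ n) (hV : IsSDPSolver A V) (t : ℕ)
    (θ μ : ℝ) (hθ : 0 ≤ θ) :
    1 ≤ (walk m V t).toOuterMeasure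
        {σ | WalkInvariant σ ∧ σ.alive = ∅ ∧ ∀ i, |A.mulVec σ.pos i| ≤ μ} +
      ENNReal.ofReal (2 * n * Real.exp (-(t * stepSize m n ^ 2 / 4)) +
        2 * m * Real.exp (θ ^ 2 * herpvdisc A ^ 2 * (t * stepSize m n ^ 2) / 2 - θ * μ)) := by
  set B := Real.exp (θ ^ 2 * herpvdisc A ^ 2 * (t * stepSize m n ^ 2) / 2) with hB
  let row (η : ℝ) (i : Fin m) (σ : WalkState n) : ℝ≥0∞ :=
    ENNReal.ofReal (Real.exp (η * A.mulVec σ.pos i))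
  have hrow : ∀ i, pmfExpect (walk m V t) (row θ i) ≤ ENNReal.ofReal B ∧
      pmfExpect (walk m V t) (row (-θ) i) ≤ ENNReal.ofReal B := fun i =>
    ⟨pmfExpect_exp_row_le hV i θ t, by simpa only [neg_sq] using pmfExpect_exp_row_le hV i (-θ) t⟩
  refine (one_le_toOuterMeasure_add_pmfExpect (walk m V t)
    {σ | WalkInvariant σ ∧ σ.alive = ∅ ∧ ∀ i, |A.mulVec σ.pos i| ≤ μ} (fun σ =>
    ENNReal.ofReal (aliveEnergy σ) + ENNReal.ofReal (Real.exp (-(θ * μ))) *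
      ∑ i, (row θ i σ + row (-θ) i σ)) ?_).trans ?_
  · intro σ hσ hbad
    have hinv := walk_support (walkInvariant_initState hn) (walkInvariant_walkStep hm hn hV) t σ hσ
    by_cases halive : σ.alive = ∅
    · have : ∃ i, μ < |A.mulVec σ.pos i| := by
        by_contra! h
        exact hbad ⟨hinv, halive, h⟩
      obtain ⟨i, hi⟩ := this
      refine le_add_left (le_trans ?_ (mul_le_mul_right (Finset.single_le_sum
        (f := fun i => row θ i σ + row (-θ) i σ) (fun _ _ => zero_le) (Finset.mem_univ i)) _))
      have key : ∀ y, μ ≤ y → 1 ≤ ENNReal.ofReal (Real.exp (-(θ * μ))) *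
          ENNReal.ofReal (Real.exp (θ * y)) := fun y hy => by
        rw [← ENNReal.ofReal_mul (Real.exp_pos _).le, ← Real.exp_add, ENNReal.one_le_ofReal,
          Real.one_le_exp_iff]
        nlinarith
      rcases lt_abs.1 hi with h | h
      · exact (key _ h.le).trans (mul_le_mul_right le_self_add _)
      · refine (key _ h.le).trans (mul_le_mul_right (le_add_left (le_of_eq ?_)) _)
        simp [row]
    · obtain ⟨i, hi⟩ := Finset.nonempty_iff_ne_empty.2 halive
      refine le_add_right (ENNReal.one_le_ofReal.2 ((hinv.one_le i).trans ?_))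
      exact Finset.single_le_sum (f := fun i => 2 - σ.pos i ^ 2)
        (fun j _ => zero_le_one.trans (hinv.one_le j)) hi
  · gcongr
    rw [pmfExpect_add, pmfExpect_const_mul, pmfExpect_sum,
      ENNReal.ofReal_add (by positivity) (by positivity)]
    refine add_le_add (pmfExpect_aliveEnergy_le hm hn hV t) ?_
    calc _ ≤ ENNReal.ofReal (Real.exp (-(θ * μ))) *
          ∑ _i : Fin m, (ENNReal.ofReal B + ENNReal.ofReal B) := by
          gcongr with i
          rw [pmfExpect_add]
          exact add_le_add (hrow i).1 (hrow i).2
      _ = _ := by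
          have hB0 : 0 ≤ B := (Real.exp_pos _).le
          rw [← ENNReal.ofReal_add hB0 hB0, Finset.sum_const, Finset.card_univ, Fintype.card_fin,
            nsmul_eq_mul, ← ENNReal.ofReal_natCast, ← ENNReal.ofReal_mul (by positivity),
            ← ENNReal.ofReal_mul (by positivity), sub_eq_add_neg, Real.exp_add, ← hB]
          ring_nf

/-! ### Rounding -/

theorem herpvdisc_nonneg (A : Matrix (Fin m) (Fin n) ℝ) : 0 ≤ herpvdisc A :=
  (herpvdisc_isLeast A).1.1

/-- The program for a single column already forces `herpvdisc A` to be at least a constant times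
each entry of that column. -/
theorem abs_entry_le (A : Matrix (Fin m) (Fin n) ℝ) (i : Fin m) (j : Fin n) :
    |A i j| ≤ 2 * herpvdisc A := by
  obtain ⟨v, hv⟩ := (herpvdisc_isLeast A).1.2 {j}
  have h1 := hv.row_le i
  have h2 := hv.half_le
  rw [Finset.sum_eq_single j (fun k _ hk => hv.norm_eq_zero k (by simpa using hk)) (by simp)] at h2
  simp only [Finset.sum_singleton, norm_smul, mul_pow, Real.norm_eq_abs,
    Finset.card_singleton, Nat.cast_one] at h1 h2
  have hlam := herpvdisc_nonneg A
  refine abs_le_of_sq_le_sq ?_ (by positivity)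
  rw [← sq_abs]
  nlinarith [mul_le_mul_of_nonneg_left h2 (sq_nonneg |A i j|), sq_nonneg (herpvdisc A)]

theorem abs_signVec_roundSigns_sub_le {x : Fin n → ℝ} {i : Fin n} {δ : ℝ} (h1 : |x i| ≤ 1)
    (h2 : 1 - δ ≤ |x i|) : |signVec (roundSigns x) i - x i| ≤ δ := by
  unfold signVec roundSigns
  split_ifs with h
  · rw [abs_of_nonneg h] at h1 h2
    rw [abs_le]
    constructor <;> push_cast <;> linarith
  · rw [abs_of_neg (not_le.1 h)] at h1 h2
    rw [abs_le]
    constructor <;> push_cast <;> linarith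

theorem norm_mulVec_roundSigns_le (hn : 2 ≤ n) {σ : WalkState n} (hσ : WalkInvariant σ)
    (hdead : σ.alive = ∅) {μ : ℝ} (hμ : 0 ≤ μ) (hrow : ∀ i, |A.mulVec σ.pos i| ≤ μ) :
    ‖A.mulVec (signVec (roundSigns σ.pos))‖ ≤ μ + 2 * herpvdisc A := by
  have hlam := herpvdisc_nonneg A
  have hn0 : (n : ℝ) ≠ 0 := by
    have : n ≠ 0 := by lia
    exact_mod_cast this
  refine (pi_norm_le_iff_of_nonneg (by positivity)).2 fun i => ?_
  have hsplit : A.mulVec (signVec (roundSigns σ.pos)) i =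
      A.mulVec σ.pos i + A.mulVec (signVec (roundSigns σ.pos) - σ.pos) i := by
    rw [Matrix.mulVec_sub, Pi.sub_apply]
    ring
  rw [hsplit, Real.norm_eq_abs]
  refine (abs_add_le _ _).trans (add_le_add (hrow i) ?_)
  calc |A.mulVec (signVec (roundSigns σ.pos) - σ.pos) i|
      ≤ ∑ j, |A i j * (signVec (roundSigns σ.pos) j - σ.pos j)| := by
        simp only [Matrix.mulVec, dotProduct, Pi.sub_apply]
        exact Finset.abs_sum_le_sum_abs _ _
    _ ≤ ∑ _j : Fin n, 2 * herpvdisc A * (1 / n) := by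
        refine Finset.sum_le_sum fun j _ => ?_
        rw [abs_mul]
        refine mul_le_mul (abs_entry_le A i j) (abs_signVec_roundSigns_sub_le (hσ.abs_le j) ?_)
          (abs_nonneg _) (by positivity)
        by_contra! h
        have := (hσ.mem_alive j).2 h
        simp [hdead] at this
    _ = 2 * herpvdisc A := by
        rw [Finset.sum_const, Finset.card_univ, Fintype.card_fin, nsmul_eq_mul]
        field_simp

theorem half_le_log {k : ℕ} (hk : 2 ≤ k) : 1 / 2 ≤ Real.log k := by
  have h : Real.log 2 ≤ Real.log k := Real.log_le_log (by norm_num) (by exact_mod_cast hk)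
  linarith [Real.log_two_gt_d9]

theorem numSteps_mul_bounds (hm : 2 ≤ m) (hn : 2 ≤ n) {κ : ℝ} (hκ : 0 ≤ κ) :
    κ * Real.log n ≤ numSteps κ m n * stepSize m n ^ 2 ∧
      numSteps κ m n * stepSize m n ^ 2 ≤ (κ + 1) * Real.log n := by
  have hs := stepSize_pos hm hn
  have hs' := stepSize_le hm hn
  have hlog := half_le_log hn
  have hs2 : 0 < stepSize m n ^ 2 := by positivity
  have hx : 0 ≤ κ * Real.log n / stepSize m n ^ 2 := by positivity
  have hmul : κ * Real.log n / stepSize m n ^ 2 * stepSize m n ^ 2 = κ * Real.log n :=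
    div_mul_cancel₀ _ hs2.ne'
  have h1 := mul_le_mul_of_nonneg_right (Nat.le_ceil (κ * Real.log n / stepSize m n ^ 2)) hs2.le
  have h2 := mul_le_mul_of_nonneg_right (Nat.ceil_lt_add_one hx).le hs2.le
  rw [add_mul, hmul] at h2
  rw [hmul] at h1
  refine ⟨h1, h2.trans ?_⟩
  nlinarith

theorem two_mul_mul_exp_le {k : ℕ} (hk : 2 ≤ k) (c : ℝ) :
    2 * k * Real.exp (-((c + 2) * Real.log k)) ≤ (k : ℝ) ^ (-c) := by
  have hk' : (2 : ℝ) ≤ k := by exact_mod_cast hk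
  have hk0 : (0 : ℝ) < k := by linarith
  calc 2 * k * Real.exp (-((c + 2) * Real.log k))
      ≤ k * k * Real.exp (-((c + 2) * Real.log k)) := by gcongr
    _ = Real.exp (Real.log k + Real.log k + -((c + 2) * Real.log k)) := by
        rw [Real.exp_add, Real.exp_add, Real.exp_log hk0]
    _ = _ := by
        rw [Real.rpow_def_of_pos hk0]
        ring_nf

theorem exists_isSDPSolver (A : Matrix (Fin m) (Fin n) ℝ) : ∃ V, IsSDPSolver A V :=
  ⟨fun S => ((herpvdisc_isLeast A).1.2 S).choose,
    fun S => ((herpvdisc_isLeast A).1.2 S).choose_spec⟩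

/-- The guarantee of the rounding algorithm, with explicit constants `κ = 4 (c + 2)` and
`C = c + 2 + (κ + 1) / 2 + 4`. -/
theorem prob_herpvdiscRounding_ge {c : ℝ} (hc : 0 < c) (hm : 2 ≤ m) (hn : 2 ≤ n)
    (hV : IsSDPSolver A V) :
    1 - ((m : ℝ) ^ (-c) + (n : ℝ) ^ (-c)) ≤
      ((herpvdiscRounding (4 * (c + 2)) m V).toOuterMeasure
        {ε | ‖A.mulVec (signVec ε)‖ ≤ (c + 2 + (4 * (c + 2) + 1) / 2 + 4) *
          Real.sqrt (Real.log m * Real.log n) * herpvdisc A}).toReal := by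
  set κ := 4 * (c + 2) with hκ
  set L := Real.sqrt (Real.log m * Real.log n) with hL
  set lam := herpvdisc A with hlam_def
  set good := {ε | ‖A.mulVec (signVec ε)‖ ≤ (c + 2 + (κ + 1) / 2 + 4) * L * lam} with hgood
  have hκ0 : 0 < κ := by positivity
  have hlam : 0 ≤ lam := herpvdisc_nonneg A
  have hlm := half_le_log hm
  have hln := half_le_log hn
  have hL2 : 1 / 2 ≤ L := Real.le_sqrt_of_sq_le (by nlinarith)
  have hLsq : L ^ 2 = Real.log m * Real.log n := Real.sq_sqrt (by positivity)
  suffices h : 1 ≤ (herpvdiscRounding κ m V).toOuterMeasure good +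
      ENNReal.ofReal ((m : ℝ) ^ (-c) + (n : ℝ) ^ (-c)) by
    have hfin : (herpvdiscRounding κ m V).toOuterMeasure good ≠ ∞ :=
      by
      refine ne_top_of_le_ne_top ENNReal.one_ne_top ?_
      rw [PMF.toOuterMeasure_apply, ← (herpvdiscRounding κ m V).tsum_coe]
      exact ENNReal.tsum_le_tsum fun ε => Set.indicator_le_self _ _ ε
    have h' := ENNReal.toReal_mono (ENNReal.add_ne_top.2 ⟨hfin, ENNReal.ofReal_ne_top⟩) h
    rw [ENNReal.toReal_add hfin ENNReal.ofReal_ne_top, ENNReal.toReal_ofReal (by positivity),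
      ENNReal.toReal_one] at h'
    linarith
  rw [herpvdiscRounding, PMF.toOuterMeasure_map_apply]
  rcases hlam.eq_or_lt with hlam0 | hlam0
  · -- If `herpvdisc A = 0` then `A = 0`, and every coloring is good.
    have hA : A = 0 := by
      ext i j
      have := abs_entry_le A i j
      rw [← hlam_def, ← hlam0, mul_zero] at this
      exact abs_nonpos_iff.1 this
    have huniv : (fun σ : WalkState n => roundSigns σ.pos) ⁻¹' good = Set.univ := by
      ext σ
      simp [hgood, hA, ← hlam0]
    refine le_add_right ?_
    rw [huniv, (PMF.toOuterMeasure_apply_eq_one_iff _ _).2 (Set.subset_univ _)]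
  obtain ⟨hT1, hT2⟩ := numSteps_mul_bounds hm hn hκ0.le
  -- `θ ^ 2 * lam ^ 2 * log n = log m` and `θ * L * lam = log m`, so that both terms of the
  -- Chernoff exponent are multiples of `log m`.
  let θ := L / (Real.log n * lam)
  let μ := (c + 2 + (κ + 1) / 2) * L * lam
  have hθμ : θ * μ = (c + 2 + (κ + 1) / 2) * Real.log m := by
    have : θ * μ = (c + 2 + (κ + 1) / 2) * (L ^ 2 / Real.log n) := by
      simp only [θ, μ]
      field_simp
    rw [this, hLsq]
    field_simp
  have hθ2 : θ ^ 2 * lam ^ 2 * Real.log n = Real.log m := by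
    have : θ ^ 2 * lam ^ 2 * Real.log n = L ^ 2 / Real.log n := by
      simp only [θ]
      field_simp
    rw [this, hLsq]
    field_simp
  refine (one_le_prob_dead_and_rows_le hm hn hV (numSteps κ m n) θ μ (by positivity)).trans
    (add_le_add (MeasureTheory.measure_mono ?_) (ENNReal.ofReal_le_ofReal ?_))
  · rintro σ ⟨hinv, hdead, hrow⟩
    refine (norm_mulVec_roundSigns_le hn hinv hdead (by positivity) hrow).trans ?_
    simp only [μ]
    nlinarith
  · rw [add_comm]
    refine add_le_add (le_trans ?_ (two_mul_mul_exp_le hm c))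
      (le_trans ?_ (two_mul_mul_exp_le hn c))
    · gcongr
      rw [hθμ, ← hlam_def]
      have := mul_le_mul_of_nonneg_left hT2 (by positivity : 0 ≤ θ ^ 2 * lam ^ 2)
      nlinarith
    · gcongr
      linarith

/-! ### Hereditary discrepancy -/

/-- The matrix `A` with all columns outside `S` replaced by zero. -/
def zeroOutside (A : Matrix (Fin m) (Fin n) ℝ) (S : Finset (Fin n)) : Matrix (Fin m) (Fin n) ℝ :=
  Matrix.of fun i j => if j ∈ S then A i j else 0

/-- Zero columns can carry arbitrary unit vectors, so a solution for `A` and `R ∩ S` extends to a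
solution for `zeroOutside A S` and `R`. -/
theorem herpvdisc_zeroOutside_le (A : Matrix (Fin m) (Fin n) ℝ) (S : Finset (Fin n)) :
    herpvdisc (zeroOutside A S) ≤ herpvdisc A := by
  refine (herpvdisc_isLeast (zeroOutside A S)).2 ⟨herpvdisc_nonneg A, fun R => ?_⟩
  obtain ⟨v, hv⟩ := (herpvdisc_isLeast A).1.2 (R ∩ S)
  refine ⟨fun j => if j ∈ R \ S then EuclideanSpace.single j 1 else v j, fun i => ?_, ?_,
    fun j hj => ?_, fun j hj => ?_⟩
  · convert hv.row_le i using 3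
    rw [← Finset.sum_inter_add_sum_sdiff R S, Finset.sum_eq_zero (s := R \ S), add_zero]
    · refine Finset.sum_congr rfl fun j hj => ?_
      simp [zeroOutside, (Finset.mem_inter.1 hj).2]
    · intro j hj
      simp [zeroOutside, (Finset.mem_sdiff.1 hj).2]
  · have hcard : (R.card : ℝ) = (R ∩ S).card + (R \ S).card := by
      exact_mod_cast (Finset.card_inter_add_card_sdiff R S).symm
    have hterm : ∀ j, ‖if j ∈ R \ S then EuclideanSpace.single j (1 : ℝ) else v j‖ ^ 2 =
        (if j ∈ R \ S then 1 else 0) + ‖v j‖ ^ 2 := fun j => by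
      split_ifs with h
      · have : j ∉ R ∩ S := by
          rw [Finset.mem_sdiff] at h
          simp [h.2]
        simp [hv.norm_eq_zero j this]
      · simp
    simp only [hterm, Finset.sum_add_distrib]
    have := hv.half_le
    simp only [Finset.sum_boole, Finset.filter_mem_eq_inter, Finset.univ_inter]
    linarith [(Nat.cast_nonneg (R \ S).card : (0 : ℝ) ≤ _)]
  · split_ifs with h
    · simp
    · exact hv.norm_le j (by
        rw [Finset.mem_sdiff] at h
        exact Finset.mem_inter.2 ⟨hj, by tauto⟩)
  · rw [if_neg (by simp [hj])]
    exact hv.norm_eq_zero j (by simp [hj])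

theorem disc_submatrix_le (A : Matrix (Fin m) (Fin n) ℝ) (S : Finset (Fin n)) (ε : Fin n → ℤˣ) :
    disc (A.submatrix id (fun j : S => (j : Fin n))) ≤ ‖(zeroOutside A S).mulVec (signVec ε)‖ := by
  refine (ciInf_le (Set.finite_range _).bddBelow fun j : S => ε j).trans_eq (congrArg _ ?_)
  ext i
  simp only [Matrix.mulVec, dotProduct, zeroOutside, signVec, Matrix.submatrix_apply, id,
    Matrix.of_apply, ite_mul, zero_mul, Finset.sum_ite_mem, Finset.univ_inter]
  exact Finset.sum_coe_sort S fun j => A i j * ((ε j : ℤ) : ℝ)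

end Walk

end HerpvDisc

theorem lemma2p1 :
    (∀ c : ℝ, 0 < c → ∃ κ C : ℝ, 0 < κ ∧ 0 < C ∧
      ∀ (m n : ℕ), 2 ≤ m → 2 ≤ n → ∀ A : Matrix (Fin m) (Fin n) ℝ,
        (∃ V, HerpvDisc.IsSDPSolver A V) ∧
        ∀ V, HerpvDisc.IsSDPSolver A V →
          1 - ((m : ℝ) ^ (-c) + (n : ℝ) ^ (-c)) ≤
            ((HerpvDisc.herpvdiscRounding κ m V).toOuterMeasure
              {ε | ‖A.mulVec (HerpvDisc.signVec ε)‖ ≤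
                C * Real.sqrt (Real.log m * Real.log n) * HerpvDisc.herpvdisc A}).toReal) ∧
    (∃ C : ℝ, 0 < C ∧
      ∀ (m n : ℕ), 2 ≤ m → 2 ≤ n → ∀ A : Matrix (Fin m) (Fin n) ℝ,
        HerpvDisc.herdisc A ≤
          C * Real.sqrt (Real.log m * Real.log n) * HerpvDisc.herpvdisc A) := by
  refine ⟨fun c hc => ⟨4 * (c + 2), c + 2 + (4 * (c + 2) + 1) / 2 + 4, by positivity, by positivity,
    fun m n hm hn A => ⟨HerpvDisc.exists_isSDPSolver A,
      fun V hV => HerpvDisc.prob_herpvdiscRounding_ge hc hm hn hV⟩⟩,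
    2 + 2 + (4 * (2 + 2) + 1) / 2 + 4, by positivity, fun m n hm hn A => ciSup_le fun S => ?_⟩
  obtain ⟨V, hV⟩ := HerpvDisc.exists_isSDPSolver (HerpvDisc.zeroOutside A S)
  have hprob := HerpvDisc.prob_herpvdiscRounding_ge (c := 2) two_pos hm hn hV
  have hsmall : ∀ {k : ℕ}, 2 ≤ k → (k : ℝ) ^ (-2 : ℝ) ≤ 1 / 4 := fun {k} hk => by
    have hk' : (2 : ℝ) ≤ k := by exact_mod_cast hk
    rw [Real.rpow_neg (by positivity), Real.rpow_two, inv_eq_one_div]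
    exact one_div_le_one_div_of_le (by norm_num) (by nlinarith)
  -- The failure probability is at most `1 / 2`, so some coloring achieves the bound.
  have hpos := (by linarith [hsmall hm, hsmall hn] : (0 : ℝ) < 1 - _).trans_le hprob
  obtain ⟨ε, hε⟩ := HerpvDisc.nonempty_of_toReal_toOuterMeasure_pos hpos
  refine (HerpvDisc.disc_submatrix_le A S ε).trans (le_trans hε ?_)
  gcongr
  exact HerpvDisc.herpvdisc_zeroOutside_le A S
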